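/- Let $G$ be a finite group. A \emph{supercharacter theory} of $G$ is a subspace $\mathsf S$ of the centre $Z(\mathbb C G)$ that is a unital subalgebra both for the ordinary product and for the Hadamard product $\sum_g a_g g\circ\sum_g b_g g=\sum_g a_gb_g g$ (whose unit is $\sum_g g$). A partition $\mathcal P$ of $G$ \emph{gives the superclasses} of $\mathsf S$ if the elements $\widehat K=\sum_{g\in K}g$, $K\in\mathcal P$, form a basis of $\mathsf S$ of orthogonal idempotents for the Hadamard product. For $\psi\in\mathrm{Irr}(G)$ (the irreducible complex characters) put $e_\psi=|G|^{-1}\sum_{g}\psi(1)\psi(g^{-1})g$; let $\mathrm{Ch}(\mathsf S)$ be the partition of $\mathrm{Irr}(G)$ for which the elements $\sum_{\psi\in X}e_\psi$, $X\in\mathrm{Ch}(\mathsf S)$, form a basis of $\mathsf S$ of orthogonal idempotents for the ordinary product. The \emph{basic $\mathsf S$-characters} are the elements of $\mathrm{BCh}(\mathsf S)=\{\sigma_X: X\in\mathrm{Ch}(\mathsf S)\}$, where $\sigma_X=\sum_{\psi\in X}\psi(1)\psi$. Let $\mathcal P$ be a partition of $G$ into $\ell$ parts, each closed under conjugation by $G$,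 with $\{1\}\in\mathcal P$. For $g\in G$ let $K_g$ be the part containing $g$. Let $C\subseteq G$ be a set of representatives for the parts of $\mathcal P$, let $\kappa:G\to C$ map each element to the representative of its part, let $x_c$ $(c\in C)$ be independent indeterminates over $\mathbb C$, and let $\Theta_{\mathcal P}=\det\bigl(x_{\kappa(gh^{-1})}\bigr)_{g,h\in G}\in\mathbb C[x_c:c\in C]$. Then $\mathcal P$ gives the superclasses of a supercharacter theory of $G$ if and only if $\Theta_{\mathcal P}$ factors over $\mathbb C$ into a product of positive powers of $\ell$ distinct linear forms, each monic in $x_1$. Moreover, if $\mathcal P$ gives the superclasses of the supercharacter theory $\mathsf S$ and \[\Theta_{\mathcal P}=\prod_{j=1}^{\ell}\Bigl(\sum_{c\in C}\xi^j_c x_c\Bigr)^{m_j}\] is a factorization into positive powers of $\ell$ distinct linear forms that are monic in $x_1$ (that is, $\xi^j_1=1$), then the basic $\mathsf S$-characters are exactly the functions $\chi_j:G\to\mathbb C$, $1\le j\le\ell$, given by \[\chi_j(g)=\frac{m_j\,\xi^j_{\kappa(g)}}{|K_g|},\] and $\chi_j(1)=m_j$ for every $j$. -/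

import Mathlib

open scoped BigOperators

noncomputable section

namespace SCT

/-- `Irr(G)`: the set of characters of irreducible (finite-dimensional) complex representations
of `G`. Up to isomorphism every such representation has underlying space `ℂⁿ`. -/
def Irr (G : Type*) [Group G] : Set (G → ℂ) :=
  {χ | ∃ (n : ℕ) (ρ : Representation ℂ G (Fin n → ℂ)), ρ.IsIrreducible ∧ ρ.character = χ}

/-- A finite group has finitely many irreducible characters (they are linearly independent). -/
theorem finite_Irr (G : Type*) [Group G] [Fintype G] : Finite (Irr G) := by
  classical
  have hc : (Nat.card G : ℂ) ≠ 0 := Nat.cast_ne_zero.mpr Nat.card_pos.ne'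
  let _ : Invertible (Nat.card G : ℂ) := invertibleOfNonzero hc
  let D : Irr G → Module.Dual ℂ (G → ℂ) := fun χ =>
    (Nat.card G : ℂ)⁻¹ • ∑ g : G, (χ : G → ℂ) g⁻¹ • LinearMap.proj g
  have hD : ∀ (χ : Irr G) (f : G → ℂ),
      D χ f = (Nat.card G : ℂ)⁻¹ * ∑ g : G, f g * (χ : G → ℂ) g⁻¹ := by
    intro χ f
    simp [D, mul_comm]
  have key : LinearIndependent ℂ (fun χ : Irr G => (χ : G → ℂ)) := by
    refine LinearIndependent.of_pairwise_dual_eq_zero_one _ D ?_ ?_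
    · rintro ⟨χ, n, ρ, hρ, rfl⟩ ⟨ψ, m, σ, hσ, rfl⟩ hne
      rw [hD]
      have := hρ
      have := hσ
      rw [Representation.char_orthonormal, if_neg]
      rintro ⟨φ⟩
      exact hne (Subtype.ext (Representation.char_iso φ))
    · rintro ⟨χ, n, ρ, hρ, rfl⟩
      rw [hD]
      have := hρ
      rw [Representation.char_orthonormal, if_pos ⟨Representation.Equiv.refl ρ⟩]
  exact key.finite

instance instFintypeIrr (G : Type*) [Group G] [Fintype G] : Fintype (Irr G) :=
  haveI := finite_Irr G
  Fintype.ofFinite _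

/-- The linear form `∑_c a_c x_c`. -/
def linForm {σ : Type*} [Fintype σ] (a : σ → ℂ) : MvPolynomial σ ℂ :=
  ∑ c : σ, MvPolynomial.C (a c) * MvPolynomial.X c

/-- `Θ = ∏_j (∑_c ξ^j_c x_c)^{m_j}` is a factorization into (positive) powers of `ℓ` distinct
linear factors, each monic in the indeterminate `x_{c₁}`. -/
structure IsLinearFactorization {σ : Type*} [Fintype σ] (Θ : MvPolynomial σ ℂ) (c₁ : σ) {ℓ : ℕ}
    (ξ : Fin ℓ → σ → ℂ) (m : Fin ℓ → ℕ) : Prop where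
  eq_prod : Θ = ∏ j, linForm (ξ j) ^ m j
  pos : ∀ j, 0 < m j
  distinct : Function.Injective fun j => linForm (ξ j)
  monic : ∀ j, ξ j c₁ = 1

variable {G : Type*} [Group G] [Fintype G]

/-- The Hadamard product `(∑ a_g g) ∘ (∑ b_g g) = ∑ a_g b_g g` on the group algebra. -/
def hadamard (a b : MonoidAlgebra ℂ G) : MonoidAlgebra ℂ G :=
  ∑ g : G, MonoidAlgebra.single g (a.coeff g * b.coeff g)

/-- The sum `K̂ = ∑_{g ∈ K} g` in the group algebra. -/
def setSum (K : Finset G) : MonoidAlgebra ℂ G :=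
  ∑ g ∈ K, MonoidAlgebra.single g 1

/-- The central idempotent `e_ψ = |G|⁻¹ ∑_g ψ(1) ψ(g⁻¹) g`. -/
def idem (ψ : G → ℂ) : MonoidAlgebra ℂ G :=
  ∑ g : G, MonoidAlgebra.single g (ψ 1 * ψ g⁻¹ / (Fintype.card G : ℂ))

/-- `∑_{ψ ∈ X} e_ψ`. -/
def idemSum (X : Finset (Irr G)) : MonoidAlgebra ℂ G :=
  ∑ ψ ∈ X, idem (ψ : G → ℂ)

/-- The character `σ_X = ∑_{ψ ∈ X} ψ(1) ψ`. -/
def sigmaChar (X : Finset (Irr G)) : G → ℂ :=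
  fun g => ∑ ψ ∈ X, (ψ : G → ℂ) 1 * (ψ : G → ℂ) g

/-- `B` is a basis of the subspace `S` consisting of pairwise orthogonal idempotents for the
product `mul`. -/
structure IsOrthIdemBasis {A : Type*} [AddCommGroup A] [Module ℂ A] (mul : A → A → A)
    (S : Submodule ℂ A) (B : Set A) : Prop where
  idempotent : ∀ e ∈ B, mul e e = e
  orthogonal : ∀ e ∈ B, ∀ f ∈ B, e ≠ f → mul e f = 0
  linearIndep : LinearIndepOn ℂ id B
  span_eq : Submodule.span ℂ B = S

/-- A supercharacter theory of `G`: a subspace of `Z(ℂG)` that is a unital subalgebra both for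
the ordinary product (with unit `1`) and for the Hadamard product (with unit `∑_g g`). -/
structure SupercharacterTheory (G : Type*) [Group G] [Fintype G] extends
    Subalgebra ℂ (MonoidAlgebra ℂ G) where
  le_center : toSubalgebra ≤ Subalgebra.center ℂ (MonoidAlgebra ℂ G)
  hadamard_mem : ∀ a ∈ toSubalgebra, ∀ b ∈ toSubalgebra, hadamard a b ∈ toSubalgebra
  hadamard_one_mem : setSum (Finset.univ : Finset G) ∈ toSubalgebra

variable [DecidableEq G]

/-- The parts of the partition `P` of `G` are the superclasses of `S`: their sums are the basis
of orthogonal idempotents of `S` for the Hadamard product. -/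
def SupercharacterTheory.HasSuperclasses (S : SupercharacterTheory G)
    (P : Finpartition (Finset.univ : Finset G)) : Prop :=
  IsOrthIdemBasis hadamard (Subalgebra.toSubmodule S.toSubalgebra)
    {a | ∃ K ∈ P.parts, a = setSum K}

/-- The partition `Q` of `Irr(G)` is `Ch(S)`: the elements `∑_{ψ ∈ X} e_ψ`, for `X` a part of
`Q`, are the basis of orthogonal idempotents of `S` for the ordinary product. -/
def SupercharacterTheory.HasCharPartition (S : SupercharacterTheory G)
    (Q : Finpartition (Finset.univ : Finset (Irr G))) : Prop :=
  IsOrthIdemBasis (fun a b : MonoidAlgebra ℂ G => a * b)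
    (Subalgebra.toSubmodule S.toSubalgebra) {a | ∃ X ∈ Q.parts, a = idemSum X}

/-- `BCh(S) = {σ_X : X ∈ Ch(S)}`, the set of basic `S`-characters. -/
def SupercharacterTheory.BCh (S : SupercharacterTheory G) : Set (G → ℂ) :=
  {χ | ∃ Q : Finpartition (Finset.univ : Finset (Irr G)), S.HasCharPartition Q ∧
    ∃ X ∈ Q.parts, χ = sigmaChar X}

/-- The determinant of the matrix `(x_{κ(g h⁻¹)})_{g,h}`, a polynomial in the indeterminates
`x_c`, `c ∈ C`. -/
def groupDet {C : Finset G} (κ : G → C) : MvPolynomial C ℂ :=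
  Matrix.det (Matrix.of fun g h : G => (MvPolynomial.X (κ (g * h⁻¹)) : MvPolynomial C ℂ))

end SCT

end

open scoped BigOperators

noncomputable section

/-! Write `ω_ψ` for the central character of an irreducible `ψ` (`centralChar`) and `V` for the
space of elements of `ℂG` whose coefficients are constant on the parts (`fiberSpace κ`). The parts
are closed under conjugation, so `V` lies in the centre. The generic element `z = ∑ x_{κ(g)} g` of
`V` acts on the block `e_ψ ℂG`, of dimension `ψ(1)²`, as the scalar `ω_ψ(z)`, and the matrix of left
multiplication by `z` is the one defining `Θ`. Hence `Θ = ∏_ψ ω_ψ(z)^{ψ(1)²}`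
(`groupDet_eq_prod_linForm`). Each `ω_ψ(z)` is a linear form, monic in `x_1` because `{1}` is a
part. By unique factorization the question becomes how many distinct forms occur.

Central characters separate points of the centre, so there are always at least `ℓ = dim V` distinct
forms. If `V` is an algebra, distinct forms are distinct algebra homomorphisms `V → ℂ`, and Dedekind
independence gives at most `ℓ` (`card_range_classForm`). Conversely, if there are exactly `ℓ`, then
`V` is the set of central `z` with `ω_φ(z) = ω_ψ(z)` whenever `φ` and `ψ` have the same form
(`mem_fiberSpace_iff_of_card_eq`). That description is closed under multiplication.

In this case `Ch(S)` is the partition of `Irr(G)` by equality of forms. For a class `X` with form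
`ξ`, the exponent is `m = ∑_{ψ ∈ X} ψ(1)²`; since `σ_X` is constant on parts, summing it over `K_g`
gives `|K_g| σ_X(g) = m ξ_{κ(g)}` (`sigmaChar_mul_card_fiber`). -/

namespace SCT

/-! ### Central characters and central idempotents of `ℂG` -/

section GroupAlgebra

variable {G : Type*} [Group G] [Fintype G]

/-- An element of `ℂG` that acts as zero in every irreducible representation is zero. -/
theorem eq_zero_of_forall_irreducible (a : MonoidAlgebra ℂ G)
    (h : ∀ (n : ℕ) (ρ : Representation ℂ G (Fin n → ℂ)), ρ.IsIrreducible →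
      ρ.asAlgebraHom a = 0) : a = 0 := by
  have hc : NeZero (Nat.card G : ℂ) := ⟨Nat.cast_ne_zero.mpr Nat.card_pos.ne'⟩
  let A := MonoidAlgebra ℂ G
  -- Choosing a basis of a simple left ideal `m` turns it into an irreducible representation on some
  -- `ℂⁿ`, where `a` acts as zero by hypothesis.
  have key : ∀ m : Submodule A A, IsSimpleModule A m → ∀ x ∈ m, a * x = 0 := by
    intro m hm x hx
    have : Module.Finite ℂ (MonoidAlgebra ℂ G) :=
      Module.Finite.equiv (MonoidAlgebra.coeffLinearEquiv ℂ).symm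
    have : Module.Finite ℂ m :=
      Module.Finite.of_injective (m.restrictScalars ℂ).subtype Subtype.val_injective
    let e : m ≃ₗ[ℂ] (Fin (Module.finrank ℂ m) → ℂ) := (Module.finBasis ℂ m).equivFun
    let ρ : Representation ℂ G (Fin (Module.finrank ℂ m) → ℂ) :=
      (MonoidAlgebra.lift ℂ _ G).symm
        ((e.conjAlgEquiv ℂ : Module.End ℂ m →ₐ[ℂ] _).comp (Algebra.lsmul ℂ ℂ m))
    have hρ : ∀ (b : A) (y : m), ρ.asAlgebraHom b (e y) = e (b • y) := by
      intro b y
      simp [ρ, Representation.asAlgebraHom_def]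
    have hirr : ρ.IsIrreducible := by
      rw [Representation.irreducible_iff_isSimpleModule_asModule]
      let f : m ≃ₗ[A] ρ.asModule :=
        { (e.trans ρ.asModuleEquiv.symm) with
          map_smul' := fun b y => by
            apply ρ.asModuleEquiv.injective
            change e (b • y) = ρ.asModuleEquiv (b • ρ.asModuleEquiv.symm (e y))
            rw [Representation.asModuleEquiv_map_smul, LinearEquiv.apply_symm_apply, hρ] }
      exact IsSimpleModule.congr f.symm
    have h0 := hρ a ⟨x, hx⟩
    rw [h _ ρ hirr, LinearMap.zero_apply, eq_comm, map_eq_zero_iff e e.injective] at h0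
    exact congrArg Subtype.val h0
  -- By Maschke, `1` is a sum of elements of simple left ideals, so `a = a * 1` is a sum of zeros.
  have h1 : (1 : A) ∈ sSup {m : Submodule A A | IsSimpleModule A m} := by
    rw [IsSemisimpleModule.sSup_simples_eq_top]; trivial
  rw [sSup_eq_iSup', Submodule.mem_iSup_iff_exists_finsupp] at h1
  obtain ⟨f, hf, hsum⟩ := h1
  rw [← mul_one a, ← hsum, Finsupp.sum, Finset.mul_sum]
  exact Finset.sum_eq_zero fun m _ => key m.1 m.2 _ (hf m)

/-- The normalized linear extension of `ψ` to `ℂG`, `∑_g z_g g ↦ ψ(1)⁻¹ ∑_g z_g ψ(g)`. For an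
irreducible character `ψ` its restriction to the centre is the central character of `ψ`. -/
def centralChar (ψ : G → ℂ) : MonoidAlgebra ℂ G →ₗ[ℂ] ℂ where
  toFun z := (∑ g, z.coeff g * ψ g) / ψ 1
  map_add' a b := by simp [add_mul, Finset.sum_add_distrib, add_div]
  map_smul' r a := by simp [← Finset.mul_sum, mul_assoc, mul_div_assoc]

theorem centralChar_apply (ψ : G → ℂ) (z : MonoidAlgebra ℂ G) :
    centralChar ψ z = (∑ g, z.coeff g * ψ g) / ψ 1 := rfl

theorem sum_single_coeff {G : Type*} [Fintype G] (z : MonoidAlgebra ℂ G) :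
    ∑ g, MonoidAlgebra.single g (z.coeff g) = z := by
  classical
  ext g
  simp

theorem trace_asAlgebraHom {V : Type*} [AddCommGroup V] [Module ℂ V]
    (ρ : Representation ℂ G V) (z : MonoidAlgebra ℂ G) :
    LinearMap.trace ℂ V (ρ.asAlgebraHom z) = ∑ g, z.coeff g * ρ.character g := by
  conv_lhs => rw [← sum_single_coeff z]
  simp [Representation.character]

theorem finrank_ne_zero_of_irreducible {G : Type*} [Group G] {n : ℕ}
    (ρ : Representation ℂ G (Fin n → ℂ)) (hρ : ρ.IsIrreducible) : n ≠ 0 := by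
  rintro rfl
  have := (Representation.irreducible_iff_isSimpleModule_asModule ρ).mp hρ
  have h1 : Nontrivial ρ.asModule := IsSimpleModule.nontrivial (MonoidAlgebra ℂ G) _
  exact not_subsingleton_iff_nontrivial.mpr h1 (inferInstanceAs (Subsingleton (Fin 0 → ℂ)))

/-- Schur's lemma: the centre of `ℂG` acts on an irreducible representation by scalars. -/
theorem asAlgebraHom_of_mem_center {n : ℕ} (ρ : Representation ℂ G (Fin n → ℂ))
    (hρ : ρ.IsIrreducible) {z : MonoidAlgebra ℂ G}
    (hz : z ∈ Subalgebra.center ℂ (MonoidAlgebra ℂ G)) :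
    ρ.asAlgebraHom z = centralChar ρ.character z • LinearMap.id := by
  have hn : (n : ℂ) ≠ 0 := Nat.cast_ne_zero.mpr (finrank_ne_zero_of_irreducible ρ hρ)
  let f : Representation.IntertwiningMap ρ ρ := ⟨ρ.asAlgebraHom z, fun g => by
    have := congrArg ρ.asAlgebraHom
      (Subalgebra.mem_center_iff.mp hz (MonoidAlgebra.single g 1))
    simpa [Module.End.mul_eq_comp] using this.symm⟩
  obtain ⟨c, hc⟩ :=
    (Representation.IsIrreducible.algebraMap_intertwiningMap_bijective_of_isAlgClosed
    (ρ := ρ)).2 f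
  have h1 : ρ.asAlgebraHom z = c • LinearMap.id := by
    have := congrArg Representation.IntertwiningMap.toLinearMap hc
    rw [show f.toLinearMap = ρ.asAlgebraHom z from rfl] at this
    rw [← this]; rfl
  have h2 := trace_asAlgebraHom ρ z
  rw [h1, centralChar_apply, ← h2]
  simp [h1, hn]

theorem Irr.apply_one {G : Type*} [Group G] (ψ : Irr G) : ∃ n : ℕ, n ≠ 0 ∧ (ψ : G → ℂ) 1 = n := by
  obtain ⟨_, n, ρ, hρ, rfl⟩ := ψ
  exact ⟨n, finrank_ne_zero_of_irreducible ρ hρ, by simp⟩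

theorem Irr.apply_one_ne_zero {G : Type*} [Group G] (ψ : Irr G) : (ψ : G → ℂ) 1 ≠ 0 := by
  obtain ⟨n, hn, h⟩ := Irr.apply_one ψ
  simpa [h] using hn

theorem Irr.apply_conj {G : Type*} [Group G] (ψ : Irr G) (g h : G) :
    (ψ : G → ℂ) (h * g * h⁻¹) = (ψ : G → ℂ) g := by
  obtain ⟨_, n, ρ, hρ, rfl⟩ := ψ
  simp

theorem centralChar_one (ψ : Irr G) : centralChar (ψ : G → ℂ) 1 = 1 := by
  classical
  simp [centralChar_apply, MonoidAlgebra.one_def, Finsupp.single_apply, Irr.apply_one_ne_zero ψ]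

theorem centralChar_mul (ψ : Irr G) {a b : MonoidAlgebra ℂ G}
    (ha : a ∈ Subalgebra.center ℂ (MonoidAlgebra ℂ G))
    (hb : b ∈ Subalgebra.center ℂ (MonoidAlgebra ℂ G)) :
    centralChar (ψ : G → ℂ) (a * b) = centralChar (ψ : G → ℂ) a * centralChar (ψ : G → ℂ) b := by
  obtain ⟨_, n, ρ, hρ, rfl⟩ := ψ
  have hn : n ≠ 0 := finrank_ne_zero_of_irreducible ρ hρ
  have h := asAlgebraHom_of_mem_center ρ hρ (mul_mem ha hb)
  rw [map_mul, asAlgebraHom_of_mem_center ρ hρ ha, asAlgebraHom_of_mem_center ρ hρ hb] at h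
  have := congrFun (LinearMap.congr_fun h (fun _ => 1)) ⟨0, Nat.pos_of_ne_zero hn⟩
  simpa [mul_comm] using this.symm

/-- A central element of `ℂG` is determined by its central characters. -/
theorem eq_of_centralChar_eq {a b : MonoidAlgebra ℂ G}
    (ha : a ∈ Subalgebra.center ℂ (MonoidAlgebra ℂ G))
    (hb : b ∈ Subalgebra.center ℂ (MonoidAlgebra ℂ G))
    (h : ∀ ψ : Irr G, centralChar (ψ : G → ℂ) a = centralChar (ψ : G → ℂ) b) : a = b := by
  rw [← sub_eq_zero]
  refine eq_zero_of_forall_irreducible _ fun n ρ hρ => ?_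
  rw [asAlgebraHom_of_mem_center ρ hρ (sub_mem ha hb), map_sub,
    h ⟨ρ.character, n, ρ, hρ, rfl⟩, sub_self, zero_smul]

theorem mem_center_iff_coeff_conj {G : Type*} [Group G] {z : MonoidAlgebra ℂ G} :
    z ∈ Subalgebra.center ℂ (MonoidAlgebra ℂ G) ↔
      ∀ g h : G, z.coeff (h * g * h⁻¹) = z.coeff g := by
  rw [Subalgebra.mem_center_iff]
  constructor
  · intro hz g h
    have := congrArg (fun a => a.coeff (h * g)) (hz (MonoidAlgebra.single h 1))
    simpa [mul_assoc, eq_comm] using this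
  · intro hz b
    induction b using MonoidAlgebra.induction_on with
    | of h =>
      ext g
      have := hz (h⁻¹ * g) h
      simpa [eq_comm, mul_assoc] using this
    | add a b ha hb => rw [add_mul, mul_add, ha, hb]
    | smul r a ha => rw [smul_mul_assoc, mul_smul_comm, ha]

theorem coeff_idem (ψ : G → ℂ) (g : G) :
    (idem ψ).coeff g = ψ 1 * ψ g⁻¹ / (Fintype.card G : ℂ) := by
  classical
  simp [idem, Finsupp.single_apply]

theorem idem_mem_center (ψ : Irr G) :
    idem (ψ : G → ℂ) ∈ Subalgebra.center ℂ (MonoidAlgebra ℂ G) := by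
  rw [mem_center_iff_coeff_conj]
  intro g h
  have := Irr.apply_conj ψ g⁻¹ h
  rw [coeff_idem, coeff_idem, ← this]
  simp [mul_assoc]

theorem centralChar_idem [DecidableEq (Irr G)] (φ ψ : Irr G) :
    centralChar (φ : G → ℂ) (idem (ψ : G → ℂ)) = if φ = ψ then 1 else 0 := by
  have hc : (Nat.card G : ℂ) ≠ 0 := Nat.cast_ne_zero.mpr Nat.card_pos.ne'
  let _ : Invertible (Nat.card G : ℂ) := invertibleOfNonzero hc
  have h : centralChar (φ : G → ℂ) (idem (ψ : G → ℂ)) = (ψ : G → ℂ) 1 / (φ : G → ℂ) 1 *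
      ((Nat.card G : ℂ)⁻¹ * ∑ g : G, (φ : G → ℂ) g * (ψ : G → ℂ) g⁻¹) := by
    rw [centralChar_apply, Finset.mul_sum, Finset.mul_sum, Finset.sum_div]
    refine Finset.sum_congr rfl fun g _ => ?_
    rw [coeff_idem, Nat.card_eq_fintype_card]
    ring
  rw [h]
  have h1 := Irr.apply_one_ne_zero φ
  split_ifs with hφψ
  · subst hφψ
    rw [div_self h1, one_mul]
    obtain ⟨_, n, ρ, hρ, rfl⟩ := φ
    have := hρ
    rw [Representation.char_orthonormal, if_pos ⟨Representation.Equiv.refl ρ⟩]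
  · obtain ⟨_, n, ρ, hρ, rfl⟩ := φ
    obtain ⟨_, m, σ, hσ, rfl⟩ := ψ
    have := hρ
    have := hσ
    rw [Representation.char_orthonormal, if_neg, mul_zero]
    rintro ⟨f⟩
    exact hφψ (Subtype.ext (Representation.char_iso f).symm)

/-- Both sides are central, so it suffices to compare central characters, and `ω_φ(e_ψ)` is the
Kronecker delta. -/
theorem mul_idem {z : MonoidAlgebra ℂ G} (hz : z ∈ Subalgebra.center ℂ (MonoidAlgebra ℂ G))
    (ψ : Irr G) : z * idem (ψ : G → ℂ) = centralChar (ψ : G → ℂ) z • idem (ψ : G → ℂ) := by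
  classical
  refine eq_of_centralChar_eq (mul_mem hz (idem_mem_center ψ))
    (Subalgebra.smul_mem _ (idem_mem_center ψ) _) fun φ => ?_
  rw [centralChar_mul φ hz (idem_mem_center ψ), map_smul, centralChar_idem]
  split_ifs with h
  · rw [h, smul_eq_mul]
  · simp

theorem sum_centralChar_smul_idem {z : MonoidAlgebra ℂ G}
    (hz : z ∈ Subalgebra.center ℂ (MonoidAlgebra ℂ G)) :
    ∑ ψ : Irr G, centralChar (ψ : G → ℂ) z • idem (ψ : G → ℂ) = z := by
  classical
  refine eq_of_centralChar_eq
    (Subalgebra.sum_mem _ fun ψ _ => Subalgebra.smul_mem _ (idem_mem_center ψ) _) hz fun φ => ?_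
  simp [centralChar_idem]

theorem sum_idem : ∑ ψ : Irr G, idem (ψ : G → ℂ) = 1 := by
  have := sum_centralChar_smul_idem (G := G) (one_mem (Subalgebra.center ℂ (MonoidAlgebra ℂ G)))
  simpa [centralChar_one] using this

theorem idem_mul_idem [DecidableEq (Irr G)] (φ ψ : Irr G) :
    idem (φ : G → ℂ) * idem (ψ : G → ℂ) = if φ = ψ then idem (ψ : G → ℂ) else 0 := by
  rw [mul_idem (idem_mem_center φ), centralChar_idem]
  simp [eq_comm]

end GroupAlgebra

/-! ### Linear forms and uniqueness of their factorizations -/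

section LinearForms

variable {σ : Type*} [Fintype σ]

theorem coeff_single_linForm (a : σ → ℂ) (c : σ) :
    (linForm a).coeff (Finsupp.single c 1) = a c := by
  classical
  simp [linForm, MvPolynomial.coeff_sum, MvPolynomial.coeff_C_mul, MvPolynomial.coeff_X,
    Finsupp.single_left_inj]

theorem linForm_injective : Function.Injective (linForm : (σ → ℂ) → MvPolynomial σ ℂ) := by
  intro a b h
  funext c
  rw [← coeff_single_linForm a, h, coeff_single_linForm]

theorem eval_linForm (a x : σ → ℂ) : MvPolynomial.eval x (linForm a) = ∑ c, a c * x c := by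
  simp [linForm]

/-- The form has total degree one, and its coefficient `1` at `x_c` rules out non-unit constant
factors. -/
theorem irreducible_linForm {a : σ → ℂ} {c : σ} (h : a c = 1) : Irreducible (linForm a) := by
  refine MvPolynomial.irreducible_of_totalDegree_eq_one (le_antisymm ?_ ?_) fun x hx => ?_
  · refine MvPolynomial.totalDegree_finsetSum_le fun i _ => ?_
    refine (MvPolynomial.totalDegree_mul _ _).trans ?_
    simp
  · have := MvPolynomial.le_totalDegree (p := linForm a) (s := Finsupp.single c 1)
      (by simp [coeff_single_linForm, h])
    simpa using this
  · have := hx (Finsupp.single c 1)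
    rw [coeff_single_linForm, h] at this
    exact isUnit_of_dvd_one this

theorem eq_of_associated_linForm {a b : σ → ℂ} {c : σ} (ha : a c = 1) (hb : b c = 1)
    (h : Associated (linForm a) (linForm b)) : a = b := by
  obtain ⟨u, hu⟩ := h
  obtain ⟨r, -, hr⟩ := MvPolynomial.isUnit_iff_eq_C_of_isReduced.mp u.isUnit
  have key : ∀ d, a d * r = b d := fun d => by
    have := congrArg (MvPolynomial.coeff (Finsupp.single d 1)) hu
    rwa [hr, mul_comm, MvPolynomial.coeff_C_mul, coeff_single_linForm, coeff_single_linForm,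
      mul_comm] at this
  have hr1 : r = 1 := by simpa [ha, hb] using key c
  funext d
  simpa [hr1] using key d

/-- Uniqueness of a factorization into powers of linear forms that are monic in the same
indeterminate. -/
theorem sum_multiplicity_eq_of_prod_linForm_eq {ι κ : Type*} [Fintype ι] [Fintype κ]
    [DecidableEq (σ → ℂ)] {f : ι → σ → ℂ} {g : κ → σ → ℂ} {n : ι → ℕ} {m : κ → ℕ} {c : σ}
    (hf : ∀ i, f i c = 1) (hg : ∀ j, g j c = 1)
    (h : ∏ i, linForm (f i) ^ n i = ∏ j, linForm (g j) ^ m j) (a : σ → ℂ) :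
    ∑ i with f i = a, n i = ∑ j with g j = a, m j := by
  classical
  -- Unique factorization matches the two multisets of irreducible factors up to units; monicity
  -- then upgrades association to equality, and the multiplicity of `a` is a count.
  have key : Multiset.Rel Associated
      ((∑ i, Multiset.replicate (n i) (f i)).map linForm)
      ((∑ j, Multiset.replicate (m j) (g j)).map linForm) := by
    refine UniqueFactorizationMonoid.factors_unique ?_ ?_ ?_
    · intro x hx
      simp only [Multiset.mem_map, Multiset.mem_sum, Multiset.mem_replicate] at hx
      obtain ⟨_, ⟨i, -, -, rfl⟩, rfl⟩ := hx
      exact irreducible_linForm (hf i)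
    · intro x hx
      simp only [Multiset.mem_map, Multiset.mem_sum, Multiset.mem_replicate] at hx
      obtain ⟨_, ⟨i, -, -, rfl⟩, rfl⟩ := hx
      exact irreducible_linForm (hg i)
    · rw [← Multiset.coe_mapAddMonoidHom, map_sum, map_sum, Multiset.prod_sum, Multiset.prod_sum]
      simp [h]
  rw [Multiset.rel_map] at key
  have heq : (∑ i, Multiset.replicate (n i) (f i)) = ∑ j, Multiset.replicate (m j) (g j) := by
    rw [← Multiset.rel_eq]
    refine key.mono fun x hx y hy hxy => ?_
    simp only [Multiset.mem_sum, Multiset.mem_replicate] at hx hy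
    obtain ⟨i, -, -, rfl⟩ := hx
    obtain ⟨j, -, -, rfl⟩ := hy
    exact eq_of_associated_linForm (hf i) (hg j) hxy
  have := congrArg (Multiset.count a) heq
  simpa [Multiset.count_sum', Multiset.count_replicate, Finset.sum_filter] using this

end LinearForms

/-! ### The determinant of left multiplication by a central element -/

section Determinant

/-- If `z` acts on the left as the scalar `w i` on `e i`, for a complete family of orthogonal
idempotents `e i`, then the determinant of left multiplication by `z` is
`∏ i, w i ^ dim (e i A)`. -/
theorem det_mulLeft_eq_prod {k A ι : Type*} [Field k] [Ring A] [Algebra k A]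
    [FiniteDimensional k A] [Fintype ι] {e : ι → A}
    (he : CompleteOrthogonalIdempotents e) {z : A} {w : ι → k} (hz : ∀ i, z * e i = w i • e i) :
    LinearMap.det (LinearMap.mulLeft k z) =
      ∏ i, w i ^ Module.finrank k (LinearMap.range (LinearMap.mulLeft k (e i))) := by
  classical
  let R : ι → Submodule k A := fun i => LinearMap.range (LinearMap.mulLeft k (e i))
  have hR : ∀ i, ∀ x ∈ R i, e i * x = x := by
    rintro i _ ⟨y, rfl⟩
    simp [← mul_assoc, (he.idem i).eq]
  have hint : DirectSum.IsInternal R := by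
    refine DirectSum.isInternal_submodule_of_iSupIndep_of_iSup_eq_top ?_ ?_
    · rw [iSupIndep_def]
      intro i
      rw [Submodule.disjoint_def]
      intro x hx hx'
      have hle : ⨆ (j) (_ : j ≠ i), R j ≤ LinearMap.ker (LinearMap.mulLeft k (e i)) := by
        refine iSup₂_le fun j hj => ?_
        rintro _ ⟨y, rfl⟩
        simp [← mul_assoc, he.ortho hj.symm]
      rw [← hR i x hx]
      exact hle hx'
    · rw [eq_top_iff]
      intro x _
      rw [← one_mul x, ← he.complete, Finset.sum_mul]
      exact Submodule.sum_mem _ fun i _ => Submodule.mem_iSup_of_mem i ⟨x, rfl⟩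
  let b := hint.collectedBasis fun i => Module.finBasis k (R i)
  rw [← LinearMap.det_toMatrix b]
  have hdiag : LinearMap.toMatrix b b (LinearMap.mulLeft k z) =
      Matrix.diagonal fun x => w x.1 := by
    ext x y
    have hy : LinearMap.mulLeft k z (b y) = w y.1 • b y := by
      have hm : b y ∈ R y.1 := hint.collectedBasis_mem _ y
      rw [LinearMap.mulLeft_apply, ← hR _ _ hm, ← mul_assoc, hz, smul_mul_assoc]
    rw [LinearMap.toMatrix_apply, hy, Matrix.diagonal_apply]
    rcases eq_or_ne x y with rfl | hxy
    · simp
    · simp [hxy]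
  rw [hdiag, Matrix.det_diagonal, Fintype.prod_sigma]
  simp [R]

variable {G : Type*} [Group G] [Fintype G]

theorem toMatrix_mulLeft [DecidableEq G] (z : MonoidAlgebra ℂ G) :
    LinearMap.toMatrix (MonoidAlgebra.basis G ℂ) (MonoidAlgebra.basis G ℂ)
      (LinearMap.mulLeft ℂ z) = Matrix.of fun g h : G => z.coeff (g * h⁻¹) := by
  ext g h
  simp [LinearMap.toMatrix_apply, MonoidAlgebra.basis]

theorem trace_mulLeft (z : MonoidAlgebra ℂ G) :
    LinearMap.trace ℂ _ (LinearMap.mulLeft ℂ z) = Fintype.card G * z.coeff 1 := by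
  classical
  rw [LinearMap.trace_eq_matrix_trace ℂ (MonoidAlgebra.basis G ℂ), toMatrix_mulLeft]
  simp [Matrix.trace]

/-- The degree of an irreducible character. -/
def Irr.degree {G : Type*} [Group G] (ψ : Irr G) : ℕ := (Irr.apply_one ψ).choose

theorem Irr.degree_pos {G : Type*} [Group G] (ψ : Irr G) : 0 < Irr.degree ψ :=
  Nat.pos_of_ne_zero (Irr.apply_one ψ).choose_spec.1

theorem Irr.degree_eq {G : Type*} [Group G] (ψ : Irr G) : (ψ : G → ℂ) 1 = Irr.degree ψ :=
  (Irr.apply_one ψ).choose_spec.2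

instance finiteDimensional_groupAlgebra : FiniteDimensional ℂ (MonoidAlgebra ℂ G) :=
  Module.Finite.of_basis (MonoidAlgebra.basis G ℂ)

theorem completeOrthogonalIdempotents_idem :
    CompleteOrthogonalIdempotents fun ψ : Irr G => idem (ψ : G → ℂ) := by
  classical
  refine ⟨⟨fun ψ => ?_, fun φ ψ h => ?_⟩, sum_idem⟩
  · simp [IsIdempotentElem, idem_mul_idem]
  · simp [idem_mul_idem, h]

/-- The rank of an idempotent is its trace, and left multiplication by `e_ψ` has trace `|G|` times
the coefficient of `e_ψ` at `1`. -/
theorem finrank_range_mulLeft_idem (ψ : Irr G) :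
    Module.finrank ℂ (LinearMap.range (LinearMap.mulLeft ℂ (idem (ψ : G → ℂ)))) =
      Irr.degree ψ ^ 2 := by
  have hidem : IsIdempotentElem (LinearMap.mulLeft ℂ (idem (ψ : G → ℂ))) := by
    ext x
    simp [← mul_assoc, (completeOrthogonalIdempotents_idem.idem ψ).eq]
  have h := ((LinearMap.isProj_range_iff_isIdempotentElem _).mpr hidem).trace
  have hG : (Fintype.card G : ℂ) ≠ 0 := Nat.cast_ne_zero.mpr Fintype.card_ne_zero
  rw [trace_mulLeft, coeff_idem, inv_one, Irr.degree_eq, mul_div_cancel₀ _ hG] at h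
  rw [pow_two]
  exact_mod_cast h.symm

theorem det_coeff_mul_inv [DecidableEq G] {z : MonoidAlgebra ℂ G}
    (hz : z ∈ Subalgebra.center ℂ (MonoidAlgebra ℂ G)) :
    (Matrix.of fun g h : G => z.coeff (g * h⁻¹)).det =
      ∏ ψ : Irr G, centralChar (ψ : G → ℂ) z ^ Irr.degree ψ ^ 2 := by
  rw [← toMatrix_mulLeft, LinearMap.det_toMatrix,
    det_mulLeft_eq_prod completeOrthogonalIdempotents_idem (fun ψ => mul_idem hz ψ)]
  simp only [finrank_range_mulLeft_idem]

end Determinant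

/-! ### Complex conjugation of irreducible characters -/

section Conjugation

variable {G : Type*} [Group G] [Fintype G]

/-- The conjugate-linear anti-involution `∑_g z_g g ↦ ∑_g conj(z_g) g⁻¹` of `ℂG`. -/
def conjInv (z : MonoidAlgebra ℂ G) : MonoidAlgebra ℂ G :=
  ∑ g, MonoidAlgebra.single g (starRingEnd ℂ (z.coeff g⁻¹))

theorem coeff_conjInv (z : MonoidAlgebra ℂ G) (g : G) :
    (conjInv z).coeff g = starRingEnd ℂ (z.coeff g⁻¹) := by
  classical
  simp [conjInv, Finsupp.single_apply]

theorem coeff_mul_eq_sum (a b : MonoidAlgebra ℂ G) (x : G) :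
    (a * b).coeff x = ∑ g, a.coeff g * b.coeff (g⁻¹ * x) := by
  conv_lhs => rw [← sum_single_coeff a, Finset.sum_mul]
  simp

theorem conjInv_mul (a b : MonoidAlgebra ℂ G) : conjInv (a * b) = conjInv b * conjInv a := by
  ext x
  simp only [coeff_conjInv, coeff_mul_eq_sum, map_sum, map_mul]
  refine Fintype.sum_equiv (Equiv.mulLeft x) _ _ fun g => ?_
  simp [mul_comm]

/-- A positivity argument shows that `e = e_ψ` equals `e* = conjInv e`. Both are central
idempotents, so `e e* = c e` with `c ∈ {0, 1}`. The coefficient at `1` of `(e - e*)(e - e*)*` is the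
sum of the squared norms of the coefficients of `e - e*`, and also `2ct - 2t` with `t = ψ(1)²/|G| >
0`. Thus `c = 0` is impossible, and `c = 1` makes the sum vanish. -/
theorem Irr.apply_inv (ψ : Irr G) (g : G) :
    (ψ : G → ℂ) g⁻¹ = starRingEnd ℂ ((ψ : G → ℂ) g) := by
  classical
  have hG : (Fintype.card G : ℂ) ≠ 0 := Nat.cast_ne_zero.mpr Fintype.card_ne_zero
  obtain ⟨t, ht⟩ : ∃ t : ℝ, t = Irr.degree ψ ^ 2 / Fintype.card G := ⟨_, rfl⟩
  have ht0 : 0 < t := by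
    have := Irr.degree_pos ψ
    rw [ht]
    positivity
  set e := idem (ψ : G → ℂ) with he
  have hee : e * e = e := by rw [he, idem_mul_idem, if_pos rfl]
  have hss : conjInv e * conjInv e = conjInv e := by rw [← conjInv_mul, hee]
  have hc : conjInv e ∈ Subalgebra.center ℂ (MonoidAlgebra ℂ G) := by
    rw [mem_center_iff_coeff_conj]
    intro x y
    have := mem_center_iff_coeff_conj.mp (idem_mem_center ψ) x⁻¹ y
    rw [coeff_conjInv, coeff_conjInv, ← this]
    simp [mul_assoc, he]
  set c := centralChar (ψ : G → ℂ) (conjInv e) with hcdef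
  have hse : conjInv e * e = c • e := mul_idem hc ψ
  have hes : e * conjInv e = c • e := by
    rw [← hse]; exact Subalgebra.mem_center_iff.mp hc e
  have hcc : c * c = c := by rw [hcdef, ← centralChar_mul ψ hc hc, hss]
  have he1 : e.coeff 1 = (t : ℂ) := by
    rw [he, coeff_idem, inv_one, Irr.degree_eq, ht]; push_cast; ring
  have hs1 : (conjInv e).coeff 1 = (t : ℂ) := by
    rw [coeff_conjInv, inv_one, he1, Complex.conj_ofReal]
  have hnorm : ((e - conjInv e) * conjInv (e - conjInv e)).coeff 1 =
      ((∑ x, ‖(e - conjInv e).coeff x‖ ^ 2 : ℝ) : ℂ) := by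
    rw [coeff_mul_eq_sum]
    push_cast
    refine Finset.sum_congr rfl fun x _ => ?_
    rw [coeff_conjInv, mul_one, inv_inv, Complex.mul_conj, Complex.normSq_eq_norm_sq]
    push_cast; rfl
  have hneg : conjInv (e - conjInv e) = conjInv e - e := by
    ext x
    simp [coeff_conjInv]
  have hprod : (e - conjInv e) * conjInv (e - conjInv e) = (2 * c) • e - e - conjInv e := by
    rw [hneg, sub_mul, mul_sub, mul_sub, hee, hss, hse, hes, two_mul, add_smul]
    abel
  rw [hprod] at hnorm
  have hcval : c = 0 ∨ c = 1 := by
    have : c * (c - 1) = 0 := by rw [mul_sub, hcc]; ring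
    rcases mul_eq_zero.mp this with h | h
    · exact Or.inl h
    · exact Or.inr (sub_eq_zero.mp h)
  have hsum : ∑ x, ‖(e - conjInv e).coeff x‖ ^ 2 = 0 := by
    have hnn : 0 ≤ ∑ x, ‖(e - conjInv e).coeff x‖ ^ 2 := by positivity
    simp only [MonoidAlgebra.coeff_sub, MonoidAlgebra.coeff_smul, Finsupp.sub_apply,
      Finsupp.smul_apply, he1, hs1] at hnorm hnn ⊢
    rcases hcval with h | h <;> rw [h] at hnorm <;> simp only [smul_eq_mul] at hnorm <;>
      norm_cast at hnorm <;> push_cast at hnorm <;> linarith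
  have hx : e.coeff g = (conjInv e).coeff g := by
    have := (Finset.sum_eq_zero_iff_of_nonneg (fun x _ => by positivity)).mp hsum g
      (Finset.mem_univ g)
    simpa [sub_eq_zero] using this
  rw [coeff_conjInv, he, coeff_idem, coeff_idem, inv_inv, Irr.degree_eq] at hx
  have hd0 : (Irr.degree ψ : ℂ) ≠ 0 := Nat.cast_ne_zero.mpr (Irr.degree_pos ψ).ne'
  simp only [map_div₀, map_mul, Complex.conj_natCast] at hx
  field_simp at hx
  exact hx

end Conjugation

/-! ### The space of elements constant on fibres, and its linear forms -/

section Fibers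

/-- The subspace of `ℂG` of elements whose coefficients are constant on the fibres of `κ`. -/
def fiberSpace {G σ : Type*} (κ : G → σ) : Submodule ℂ (MonoidAlgebra ℂ G) where
  carrier := {z | ∀ g h, κ g = κ h → z.coeff g = z.coeff h}
  zero_mem' := by simp
  add_mem' ha hb g h hgh := by simp [ha g h hgh, hb g h hgh]
  smul_mem' r a ha g h hgh := by simp [ha g h hgh]

/-- The element `∑_g x_{κ(g)} g` of `ℂG`. -/
def fiberComb {G σ : Type*} [Fintype G] (κ : G → σ) (x : σ → ℂ) : MonoidAlgebra ℂ G :=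
  ∑ g, MonoidAlgebra.single g (x (κ g))

theorem coeff_fiberComb {G σ : Type*} [Fintype G] (κ : G → σ) (x : σ → ℂ) (g : G) :
    (fiberComb κ x).coeff g = x (κ g) := by
  classical
  simp [fiberComb, Finsupp.single_apply]

theorem fiberComb_mem_fiberSpace {G σ : Type*} [Fintype G] (κ : G → σ) (x : σ → ℂ) :
    fiberComb κ x ∈ fiberSpace κ := fun g h hgh => by
  rw [coeff_fiberComb, coeff_fiberComb, hgh]

/-- For surjective `κ`, functions on the target are the same as elements of `fiberSpace κ`. -/
def fiberSpaceEquiv {G σ : Type*} [Fintype G] (κ : G → σ) (hκ : Function.Surjective κ) :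
    (σ → ℂ) ≃ₗ[ℂ] fiberSpace κ where
  toFun x := ⟨fiberComb κ x, fiberComb_mem_fiberSpace κ x⟩
  map_add' x y := by ext g; simp [coeff_fiberComb]
  map_smul' r x := by ext g; simp [coeff_fiberComb]
  invFun z c := z.1.coeff (Function.surjInv hκ c)
  left_inv x := by
    funext c
    change (fiberComb κ x).coeff _ = x c
    rw [coeff_fiberComb, Function.surjInv_eq hκ]
  right_inv z := by
    ext g
    rw [coeff_fiberComb]
    exact z.2 _ _ (Function.surjInv_eq hκ _)

variable {G σ : Type*} [Group G] [Fintype G]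

theorem fiberSpace_le_center {G σ : Type*} [Group G] {κ : G → σ}
    (hconj : ∀ g h, κ (h * g * h⁻¹) = κ g) :
    fiberSpace κ ≤ Subalgebra.toSubmodule (Subalgebra.center ℂ (MonoidAlgebra ℂ G)) := by
  intro z hz
  rw [Subalgebra.mem_toSubmodule, mem_center_iff_coeff_conj]
  exact fun g h => hz _ _ (hconj g h)

variable [DecidableEq σ]

/-- The coefficients `ψ(1)⁻¹ ∑_{κ(g) = c} ψ(g)` of the linear form on the fibres of `κ` that is
given by the central character of `ψ`. -/
def classForm (κ : G → σ) (ψ : Irr G) : σ → ℂ :=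
  fun c => (∑ g with κ g = c, (ψ : G → ℂ) g) / (ψ : G → ℂ) 1

theorem classForm_apply_one {κ : G → σ} (hone : ∀ g, κ g = κ 1 → g = 1) (ψ : Irr G) :
    classForm κ ψ (κ 1) = 1 := by
  have : (Finset.univ.filter fun g => κ g = κ 1) = {1} := by
    ext g
    simpa using ⟨hone g, fun h => by rw [h]⟩
  rw [classForm, this, Finset.sum_singleton, div_self (Irr.apply_one_ne_zero ψ)]

variable [Fintype σ]

theorem centralChar_fiberComb (κ : G → σ) (ψ : Irr G) (x : σ → ℂ) :
    centralChar (ψ : G → ℂ) (fiberComb κ x) = ∑ c, classForm κ ψ c * x c := by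
  simp only [centralChar_apply, coeff_fiberComb, classForm, div_mul_eq_mul_div, ← Finset.sum_div]
  rw [← Finset.sum_fiberwise _ κ]
  congr 1
  refine Finset.sum_congr rfl fun c _ => ?_
  rw [Finset.sum_mul]
  refine Finset.sum_congr rfl fun g hg => ?_
  rw [(Finset.mem_filter.mp hg).2, mul_comm]

theorem classForm_eq_iff {κ : G → σ} (hκ : Function.Surjective κ) {φ ψ : Irr G} :
    classForm κ φ = classForm κ ψ ↔
      ∀ z ∈ fiberSpace κ, centralChar (φ : G → ℂ) z = centralChar (ψ : G → ℂ) z := by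
  constructor
  · intro h z hz
    obtain ⟨x, hx⟩ := (fiberSpaceEquiv κ hκ).surjective ⟨z, hz⟩
    obtain rfl : fiberComb κ x = z := congrArg Subtype.val hx
    rw [centralChar_fiberComb, centralChar_fiberComb, h]
  · intro h
    funext c
    have := h _ (fiberComb_mem_fiberSpace κ (Pi.single c 1))
    simpa [centralChar_fiberComb, Pi.single_apply] using this

/-- Evaluation of the linear forms `classForm κ ψ`, one coordinate for each distinct form. -/
def formEval (κ : G → σ) : (σ → ℂ) →ₗ[ℂ] (Set.range (classForm κ) → ℂ) where
  toFun x a := ∑ c, a.1 c * x c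
  map_add' x y := by funext a; simp [mul_add, Finset.sum_add_distrib]
  map_smul' r x := by
    funext a
    simp only [Pi.smul_apply, smul_eq_mul, Finset.mul_sum, RingHom.id_apply]
    exact Finset.sum_congr rfl fun c _ => by ring

theorem formEval_apply (κ : G → σ) (x : σ → ℂ) (ψ : Irr G) :
    formEval κ x ⟨classForm κ ψ, ψ, rfl⟩ = centralChar (ψ : G → ℂ) (fiberComb κ x) :=
  (centralChar_fiberComb κ ψ x).symm

/-- The values of the forms at `x` are all the central characters of the central element `fiberComb
κ x`, which they determine. -/
theorem formEval_injective {κ : G → σ} (hκ : Function.Surjective κ)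
    (hconj : ∀ g h, κ (h * g * h⁻¹) = κ g) : Function.Injective (formEval κ) := by
  intro x y hxy
  have hmem := fun x => fiberSpace_le_center hconj (fiberComb_mem_fiberSpace κ x)
  have h : fiberComb κ x = fiberComb κ y :=
    eq_of_centralChar_eq (hmem x) (hmem y) fun ψ => by
      rw [← formEval_apply, ← formEval_apply, hxy]
  funext c
  obtain ⟨g, rfl⟩ := hκ c
  rw [← coeff_fiberComb κ x, h, coeff_fiberComb]

theorem card_le_card_range_classForm {κ : G → σ} (hκ : Function.Surjective κ)
    (hconj : ∀ g h, κ (h * g * h⁻¹) = κ g) :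
    Fintype.card σ ≤ Nat.card (Set.range (classForm κ)) := by
  classical
  have := LinearMap.finrank_le_finrank_of_injective (formEval_injective hκ hconj)
  simpa [← Nat.card_eq_fintype_card] using this

/-- If the number of distinct forms is the number of fibres, then `fiberSpace κ` is cut out of the
centre by equalities between central characters. -/
theorem mem_fiberSpace_iff_of_card_eq {κ : G → σ} (hκ : Function.Surjective κ)
    (hconj : ∀ g h, κ (h * g * h⁻¹) = κ g)
    (hcard : Nat.card (Set.range (classForm κ)) = Fintype.card σ) {z : MonoidAlgebra ℂ G}
    (hz : z ∈ Subalgebra.center ℂ (MonoidAlgebra ℂ G)) :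
    z ∈ fiberSpace κ ↔ ∀ φ ψ : Irr G, classForm κ φ = classForm κ ψ →
      centralChar (φ : G → ℂ) z = centralChar (ψ : G → ℂ) z := by
  classical
  refine ⟨fun h φ ψ hφψ => (classForm_eq_iff hκ).mp hφψ z h, fun h => ?_⟩
  -- With equal dimensions, injectivity gives surjectivity: any values prescribed on the distinct
  -- forms, here those of `z`, come from an element of `fiberSpace κ`.
  have hsurj : Function.Surjective (formEval κ) := by
    refine (LinearMap.injective_iff_surjective_of_finrank_eq_finrank ?_).mp
      (formEval_injective hκ hconj)
    simp [← Nat.card_eq_fintype_card, hcard]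
  obtain ⟨x, hx⟩ := hsurj fun a => centralChar (a.2.choose : G → ℂ) z
  have : fiberComb κ x = z := by
    refine eq_of_centralChar_eq
      (fiberSpace_le_center hconj (fiberComb_mem_fiberSpace κ x)) hz fun ψ => ?_
    rw [← formEval_apply, hx]
    have hex : ∃ φ, classForm κ φ = classForm κ ψ := ⟨ψ, rfl⟩
    exact h _ _ hex.choose_spec
  rw [← this]
  exact fiberComb_mem_fiberSpace κ x

/-- The central character of `ψ` as an algebra homomorphism on a subalgebra of the centre. -/
def centralCharHom {S : Subalgebra ℂ (MonoidAlgebra ℂ G)}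
    (hS : S ≤ Subalgebra.center ℂ (MonoidAlgebra ℂ G)) (ψ : Irr G) : S →ₐ[ℂ] ℂ :=
  AlgHom.ofLinearMap (centralChar (ψ : G → ℂ) ∘ₗ S.val.toLinearMap) (centralChar_one ψ)
    fun s t => centralChar_mul ψ (hS s.2) (hS t.2)

theorem centralCharHom_apply {S : Subalgebra ℂ (MonoidAlgebra ℂ G)}
    (hS : S ≤ Subalgebra.center ℂ (MonoidAlgebra ℂ G)) (ψ : Irr G) (s : S) :
    centralCharHom hS ψ s = centralChar (ψ : G → ℂ) s := rfl

/-- If `fiberSpace κ` is a subalgebra, then there are as many distinct forms as fibres. -/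
theorem card_range_classForm {κ : G → σ} (hκ : Function.Surjective κ)
    (hconj : ∀ g h, κ (h * g * h⁻¹) = κ g) {S : Subalgebra ℂ (MonoidAlgebra ℂ G)}
    (hS : Subalgebra.toSubmodule S = fiberSpace κ) :
    Nat.card (Set.range (classForm κ)) = Fintype.card σ := by
  classical
  refine le_antisymm ?_ (card_le_card_range_classForm hκ hconj)
  have hmem : ∀ s : S, (s : MonoidAlgebra ℂ G) ∈ fiberSpace κ := fun s => by
    rw [← hS]; exact s.2
  have hc : ∀ s : S, (s : MonoidAlgebra ℂ G) ∈ Subalgebra.center ℂ (MonoidAlgebra ℂ G) :=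
    fun s => fiberSpace_le_center hconj (hmem s)
  have hle : S ≤ Subalgebra.center ℂ (MonoidAlgebra ℂ G) := fun s hs => hc ⟨s, hs⟩
  let F : Set.range (classForm κ) → S →ₐ[ℂ] ℂ := fun a => centralCharHom hle a.2.choose
  have hF : Function.Injective F := by
    intro a b hab
    have key : classForm κ a.2.choose = classForm κ b.2.choose := by
      rw [classForm_eq_iff hκ]
      intro z hz
      rw [← hS] at hz
      rw [← centralCharHom_apply hle _ ⟨z, hz⟩, ← centralCharHom_apply hle _ ⟨z, hz⟩]
      exact AlgHom.congr_fun hab ⟨z, hz⟩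
    exact Subtype.ext (a.2.choose_spec.symm.trans (key.trans b.2.choose_spec))
  -- Dedekind: distinct algebra homomorphisms are linearly independent in the dual of `S`, whose
  -- dimension is the number of fibres.
  have hD := (linearIndependent_algHom_toLinearMap ℂ S ℂ).comp F hF
  have h1 := hD.fintype_card_le_finrank
  have h2 : Module.finrank ℂ S = Fintype.card σ := by
    have : Module.finrank ℂ (Subalgebra.toSubmodule S) = Fintype.card σ := by
      rw [hS, ← (fiberSpaceEquiv κ hκ).finrank_eq, Module.finrank_fintype_fun_eq_card]
    exact this
  rw [Module.finrank_linearMap_self, h2] at h1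
  rwa [Nat.card_eq_fintype_card]

/-- The values of `∑_{ψ ∈ X} ψ(1)ψ` for a class `X` of characters with the same form. -/
theorem sigmaChar_mul_card_fiber {κ : G → σ} (hκ : Function.Surjective κ)
    (hconj : ∀ g h, κ (h * g * h⁻¹) = κ g)
    (hcard : Nat.card (Set.range (classForm κ)) = Fintype.card σ) (X : Finset (Irr G))
    (ψ₀ : Irr G) (hX : ∀ ψ, ψ ∈ X ↔ classForm κ ψ = classForm κ ψ₀) (g : G) :
    sigmaChar X g * (Finset.univ.filter fun h => κ h = κ g).card =
      (∑ ψ ∈ X, Irr.degree ψ ^ 2 : ℕ) * classForm κ ψ₀ (κ g) := by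
  have hG : (Fintype.card G : ℂ) ≠ 0 := Nat.cast_ne_zero.mpr Fintype.card_ne_zero
  have hc : idemSum X ∈ Subalgebra.center ℂ (MonoidAlgebra ℂ G) :=
    Subalgebra.sum_mem _ fun ψ _ => idem_mem_center ψ
  -- The coefficients of `idemSum X` are the conjugates of the values of `σ_X` divided by `|G|`, so
  -- this membership makes `σ_X` constant on fibres.
  have hmem : idemSum X ∈ fiberSpace κ := by
    rw [mem_fiberSpace_iff_of_card_eq hκ hconj hcard hc]
    intro φ ψ hφψ
    simp [idemSum, centralChar_idem, hX, hφψ]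
  have hcoeff : ∀ x, (idemSum X).coeff x = starRingEnd ℂ (sigmaChar X x) / Fintype.card G := by
    intro x
    simp [idemSum, sigmaChar, coeff_idem, Irr.apply_inv, Irr.degree_eq, Finset.sum_div]
  have hconst : ∀ h, κ h = κ g → sigmaChar X h = sigmaChar X g := by
    intro h hh
    have := hmem h g hh
    rw [hcoeff, hcoeff, div_left_inj' hG] at this
    exact (starRingEnd ℂ).injective this
  have h1 : ∑ h with κ h = κ g, sigmaChar X h =
      sigmaChar X g * (Finset.univ.filter fun h => κ h = κ g).card := by
    rw [Finset.sum_congr rfl fun h hh => hconst h (Finset.mem_filter.mp hh).2, Finset.sum_const,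
      nsmul_eq_mul, mul_comm]
  rw [← h1]
  simp only [sigmaChar]
  rw [Finset.sum_comm]
  push_cast
  rw [Finset.sum_mul]
  refine Finset.sum_congr rfl fun ψ hψ => ?_
  rw [← (hX ψ).mp hψ, classForm, ← Irr.degree_eq, ← Finset.mul_sum]
  have := Irr.apply_one_ne_zero ψ
  field_simp

end Fibers

/-! ### Factorization of the group determinant -/

section GroupDeterminant

variable {G : Type*} [Group G] [Fintype G] [DecidableEq G]

theorem groupDet_eq_prod_linForm {C : Finset G} {κ : G → C}
    (hconj : ∀ g h, κ (h * g * h⁻¹) = κ g) :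
    groupDet κ = ∏ ψ : Irr G, linForm (classForm κ ψ) ^ Irr.degree ψ ^ 2 := by
  refine MvPolynomial.funext fun x => ?_
  have h := det_coeff_mul_inv
    (fiberSpace_le_center hconj (fiberComb_mem_fiberSpace κ x))
  simp only [coeff_fiberComb, centralChar_fiberComb] at h
  rw [groupDet, RingHom.map_det, map_prod]
  simp only [map_pow, eval_linForm]
  rw [← h]
  congr 1
  ext g h
  simp

end GroupDeterminant

/-- `IsOrthIdemBasis` speaks of a set, whereas dual functionals are indexed by a family. This serves
both bases: coefficients separate part sums, and central characters separate idempotent sums. -/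
theorem linearIndepOn_id_of_dual {A ι : Type*} [AddCommGroup A] [Module ℂ A] (v : ι → A)
    (D : ι → Module.Dual ℂ A) (h0 : ∀ i j, i ≠ j → D i (v j) = 0) (h1 : ∀ i, D i (v i) = 1)
    {B : Set A} (hB : B = Set.range v) : LinearIndepOn ℂ id B := by
  rw [hB]
  exact (LinearIndependent.of_pairwise_dual_eq_zero_one v D h0 h1).linearIndepOn_id

/-! ### The Hadamard idempotents -/

section Superclasses

theorem coeff_setSum {G : Type*} [DecidableEq G] (K : Finset G) (g : G) :
    (setSum K).coeff g = if g ∈ K then 1 else 0 := by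
  simp [setSum, Finsupp.single_apply]

theorem coeff_hadamard {G : Type*} [Fintype G] (a b : MonoidAlgebra ℂ G) (g : G) :
    (hadamard a b).coeff g = a.coeff g * b.coeff g := by
  classical
  simp [hadamard, Finsupp.single_apply]

variable {G σ : Type*} [Fintype G] [DecidableEq G] {P : Finpartition (Finset.univ : Finset G)}
  {κ : G → σ}

theorem span_setSum_eq_fiberSpace (hκ : ∀ g h, κ g = κ h ↔ P.part g = P.part h) :
    Submodule.span ℂ {a | ∃ K ∈ P.parts, a = setSum K} = fiberSpace κ := by
  apply le_antisymm
  · rw [Submodule.span_le]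
    rintro _ ⟨K, hK, rfl⟩ g h hgh
    have : g ∈ K ↔ h ∈ K := by
      rw [← P.part_eq_iff_mem hK, ← P.part_eq_iff_mem hK, (hκ g h).mp hgh]
    simp [coeff_setSum, this]
  · intro z hz
    have : z = ∑ K ∈ P.parts.attach,
        z.coeff (P.nonempty_of_mem_parts K.2).choose • setSum K.1 := by
      ext g
      have hg : P.part g ∈ P.parts := P.part_mem.mpr (Finset.mem_univ g)
      simp only [MonoidAlgebra.coeff_sum, Finsupp.finsetSum_apply, MonoidAlgebra.coeff_smul,
        Finsupp.smul_apply, coeff_setSum, smul_eq_mul]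
      rw [Finset.sum_eq_single ⟨P.part g, hg⟩]
      · rw [if_pos (P.mem_part_self.mpr (Finset.mem_univ g)), mul_one]
        refine hz _ _ ((hκ _ _).mpr ?_)
        rw [P.part_eq_of_mem hg (P.nonempty_of_mem_parts hg).choose_spec]
      · intro K _ hne
        rw [if_neg, mul_zero]
        exact fun hgK => hne (Subtype.ext (P.part_eq_of_mem K.2 hgK).symm)
      · exact fun h => absurd (Finset.mem_attach _ _) h
    rw [this]
    exact Submodule.sum_mem _ fun K _ =>
      Submodule.smul_mem _ _ (Submodule.subset_span ⟨K.1, K.2, rfl⟩)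

theorem isOrthIdemBasis_setSum (hκ : ∀ g h, κ g = κ h ↔ P.part g = P.part h) :
    IsOrthIdemBasis hadamard (fiberSpace κ) {a | ∃ K ∈ P.parts, a = setSum K} where
  idempotent := by
    rintro _ ⟨K, -, rfl⟩
    ext g
    simp [coeff_hadamard, coeff_setSum]
  orthogonal := by
    rintro _ ⟨K, hK, rfl⟩ _ ⟨L, hL, rfl⟩ hne
    ext g
    have : ¬ (g ∈ K ∧ g ∈ L) := fun h =>
      hne (by rw [P.eq_of_mem_parts hK hL h.1 h.2])
    by_cases h : g ∈ K <;> simp_all [coeff_hadamard, coeff_setSum]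
  linearIndep := by
    refine linearIndepOn_id_of_dual (fun K : P.parts => setSum K.1)
      (fun K => (Finsupp.lapply (P.nonempty_of_mem_parts K.2).choose) ∘ₗ
        (MonoidAlgebra.coeffLinearEquiv ℂ).toLinearMap) (fun K L hne => ?_) (fun K => ?_) ?_
    · change (setSum L.1).coeff _ = 0
      rw [coeff_setSum, if_neg]
      exact fun h => hne (Subtype.ext
        (P.eq_of_mem_parts K.2 L.2 (P.nonempty_of_mem_parts K.2).choose_spec h))
    · change (setSum K.1).coeff _ = 1
      rw [coeff_setSum, if_pos (P.nonempty_of_mem_parts K.2).choose_spec]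
    · ext a
      simp [eq_comm]
  span_eq := span_setSum_eq_fiberSpace hκ

end Superclasses

/-! ### The partition of `Irr(G)` and the basic characters -/

section CharacterPartition

variable {G σ : Type*} [Group G] [Fintype G] [DecidableEq σ] {κ : G → σ}

theorem idemSum_mem_center (X : Finset (Irr G)) :
    idemSum X ∈ Subalgebra.center ℂ (MonoidAlgebra ℂ G) :=
  Subalgebra.sum_mem _ fun ψ _ => idem_mem_center ψ

theorem centralChar_idemSum (X : Finset (Irr G)) (φ : Irr G) :
    centralChar (φ : G → ℂ) (idemSum X) = if φ ∈ X then 1 else 0 := by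
  simp [idemSum, centralChar_idem]

theorem idemSum_mul_idemSum (X Y : Finset (Irr G)) :
    idemSum X * idemSum Y = idemSum (X ∩ Y) := by
  refine eq_of_centralChar_eq (mul_mem (idemSum_mem_center X) (idemSum_mem_center Y))
    (idemSum_mem_center _) fun φ => ?_
  rw [centralChar_mul φ (idemSum_mem_center X) (idemSum_mem_center Y)]
  simp [centralChar_idemSum, ← ite_and, Finset.mem_inter, and_comm]

/-- The partition of `Irr(G)` by equality of the forms `classForm κ ψ`. -/
def formPartition (κ : G → σ) : Finpartition (Finset.univ : Finset (Irr G)) :=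
  letI : DecidableRel (Setoid.ker (classForm κ)).r := Classical.decRel _
  Finpartition.ofSetoid (Setoid.ker (classForm κ))

theorem mem_part_formPartition {X : Finset (Irr G)} (hX : X ∈ (formPartition κ).parts)
    {φ : Irr G} (hφ : φ ∈ X) (ψ : Irr G) : ψ ∈ X ↔ classForm κ ψ = classForm κ φ := by
  let _ : DecidableRel (Setoid.ker (classForm κ)).r := Classical.decRel _
  rw [← (formPartition κ).part_eq_of_mem hX hφ]
  exact Finpartition.mem_part_ofSetoid_iff_rel.trans eq_comm

variable [Fintype σ]

theorem isOrthIdemBasis_formPartition (hκ : Function.Surjective κ)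
    (hconj : ∀ g h, κ (h * g * h⁻¹) = κ g)
    (hcard : Nat.card (Set.range (classForm κ)) = Fintype.card σ) :
    IsOrthIdemBasis (fun a b : MonoidAlgebra ℂ G => a * b) (fiberSpace κ)
      {a | ∃ X ∈ (formPartition κ).parts, a = idemSum X} where
  idempotent := by
    rintro _ ⟨X, -, rfl⟩
    rw [idemSum_mul_idemSum, Finset.inter_self]
  orthogonal := by
    rintro _ ⟨X, hX, rfl⟩ _ ⟨Y, hY, rfl⟩ hne
    have : X ∩ Y = ∅ := by
      rw [Finset.eq_empty_iff_forall_notMem]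
      intro φ hφ
      rw [Finset.mem_inter] at hφ
      exact hne (by rw [(formPartition κ).eq_of_mem_parts hX hY hφ.1 hφ.2])
    rw [idemSum_mul_idemSum, this, idemSum, Finset.sum_empty]
  linearIndep := by
    have hne := fun X : (formPartition κ).parts => (formPartition κ).nonempty_of_mem_parts X.2
    refine linearIndepOn_id_of_dual (fun X : (formPartition κ).parts => idemSum X.1)
      (fun X => centralChar ((hne X).choose : G → ℂ)) (fun X Y hXY => ?_) (fun X => ?_) ?_
    · rw [centralChar_idemSum, if_neg]
      exact fun h => hXY (Subtype.ext
        ((formPartition κ).eq_of_mem_parts X.2 Y.2 (hne X).choose_spec h))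
    · rw [centralChar_idemSum, if_pos (hne X).choose_spec]
    · ext a
      simp [eq_comm]
  span_eq := by
    apply le_antisymm
    · rw [Submodule.span_le]
      rintro _ ⟨X, hX, rfl⟩
      obtain ⟨φ₀, hφ₀⟩ := (formPartition κ).nonempty_of_mem_parts hX
      refine (mem_fiberSpace_iff_of_card_eq hκ hconj hcard (idemSum_mem_center X)).mpr
        fun φ ψ h => ?_
      rw [centralChar_idemSum, centralChar_idemSum]
      simp only [mem_part_formPartition hX hφ₀, h]
    · intro z hz
      have hsum := Finset.sum_biUnion (f := fun ψ : Irr G =>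
          centralChar (ψ : G → ℂ) z • idem (ψ : G → ℂ))
        (formPartition κ).supIndep.pairwiseDisjoint
      rw [(formPartition κ).biUnion_parts,
        sum_centralChar_smul_idem (fiberSpace_le_center hconj hz)] at hsum
      rw [hsum]
      refine Submodule.sum_mem _ fun X hX => ?_
      obtain ⟨φ, hφ⟩ := (formPartition κ).nonempty_of_mem_parts hX
      have : ∑ ψ ∈ X, centralChar (ψ : G → ℂ) z • idem (ψ : G → ℂ) =
          centralChar (φ : G → ℂ) z • idemSum X := by
        rw [idemSum, Finset.smul_sum]
        refine Finset.sum_congr rfl fun ψ hψ => ?_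
        rw [(classForm_eq_iff hκ).mp ((mem_part_formPartition hX hφ ψ).mp hψ) z hz]
      exact this ▸ Submodule.smul_mem _ _ (Submodule.subset_span ⟨X, hX, rfl⟩)

/-- The parts of `Ch(S)` are the classes of characters with equal forms. -/
theorem mem_part_iff_classForm_eq (hκ : Function.Surjective κ)
    {Q : Finpartition (Finset.univ : Finset (Irr G))}
    (hQ : Submodule.span ℂ {a | ∃ X ∈ Q.parts, a = idemSum X} = fiberSpace κ)
    {X : Finset (Irr G)} (hX : X ∈ Q.parts) {φ : Irr G} (hφ : φ ∈ X) (ψ : Irr G) :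
    ψ ∈ X ↔ classForm κ ψ = classForm κ φ := by
  rw [classForm_eq_iff hκ, ← hQ]
  constructor
  · intro hψ
    refine LinearMap.eqOn_span (f := centralChar (ψ : G → ℂ)) (g := centralChar (φ : G → ℂ)) ?_
    rintro _ ⟨Y, hY, rfl⟩
    have : ψ ∈ Y ↔ φ ∈ Y := by
      rw [← Q.part_eq_iff_mem hY, ← Q.part_eq_iff_mem hY, Q.part_eq_of_mem hX hψ,
        Q.part_eq_of_mem hX hφ]
    simp [centralChar_idemSum, this]
  · intro h
    -- The idempotent of `X` itself tells members of `X` from non-members.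
    have := h _ (Submodule.subset_span ⟨X, hX, rfl⟩)
    rw [centralChar_idemSum, centralChar_idemSum, if_pos hφ] at this
    by_contra hψ
    simp [hψ] at this

/-- `Ch(S)` is forced to be the partition by forms, so each basic character comes from the class of
some `φ`. The membership condition determines `X` uniquely. -/
theorem SupercharacterTheory.mem_BCh_iff (S : SupercharacterTheory G)
    (hκ : Function.Surjective κ) (hconj : ∀ g h, κ (h * g * h⁻¹) = κ g)
    (hS : Subalgebra.toSubmodule S.toSubalgebra = fiberSpace κ) (χ : G → ℂ) :
    χ ∈ S.BCh ↔ ∃ φ : Irr G, ∀ X : Finset (Irr G),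
      (∀ ψ, ψ ∈ X ↔ classForm κ ψ = classForm κ φ) → χ = sigmaChar X := by
  constructor
  · rintro ⟨Q, hQ, X, hX, rfl⟩
    obtain ⟨φ, hφ⟩ := Q.nonempty_of_mem_parts hX
    refine ⟨φ, fun Y hY => ?_⟩
    congr 1
    ext ψ
    rw [hY, mem_part_iff_classForm_eq hκ (hQ.span_eq.trans hS) hX hφ]
  · rintro ⟨φ, h⟩
    have hpart := (formPartition κ).part_mem.mpr (Finset.mem_univ φ)
    refine ⟨formPartition κ, ?_, (formPartition κ).part φ, hpart, h _ ?_⟩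
    · rw [HasCharPartition, hS]
      exact isOrthIdemBasis_formPartition hκ hconj (card_range_classForm hκ hconj hS)
    · exact mem_part_formPartition hpart
        ((formPartition κ).mem_part_self.mpr (Finset.mem_univ φ))

variable [DecidableEq G]

/-- The supercharacter theory with underlying space `fiberSpace κ`. -/
def supercharacterTheoryOfCard (hκ : Function.Surjective κ)
    (hconj : ∀ g h, κ (h * g * h⁻¹) = κ g) (hone : ∀ g, κ g = κ 1 → g = 1)
    (hcard : Nat.card (Set.range (classForm κ)) = Fintype.card σ) : SupercharacterTheory G where
  toSubalgebra := (fiberSpace κ).toSubalgebra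
    (by
      intro g h hgh
      have : g = 1 ↔ h = 1 :=
        ⟨fun hg => hone h (by rw [← hgh, hg]), fun hh => hone g (by rw [hgh, hh])⟩
      simp [MonoidAlgebra.one_def, Finsupp.single_apply, eq_comm (a := (1 : G)), this])
    (by
      intro a b ha hb
      have hac := fiberSpace_le_center hconj ha
      have hbc := fiberSpace_le_center hconj hb
      -- Equalities between central characters survive products because central characters are
      -- multiplicative on the centre.
      rw [mem_fiberSpace_iff_of_card_eq hκ hconj hcard (mul_mem hac hbc)]
      intro φ ψ h
      rw [centralChar_mul φ hac hbc, centralChar_mul ψ hac hbc,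
        (classForm_eq_iff hκ).mp h a ha, (classForm_eq_iff hκ).mp h b hb])
  le_center := fiberSpace_le_center hconj
  hadamard_mem a ha b hb g h hgh := by
    rw [coeff_hadamard, coeff_hadamard, ha g h hgh, hb g h hgh]
  hadamard_one_mem g h hgh := by simp [coeff_setSum]

end CharacterPartition

end SCT

end

/-! ### The main theorem -/

theorem theoremB {G : Type*} [Group G] [Fintype G] [DecidableEq G]
    (P : Finpartition (Finset.univ : Finset G)) (ℓ : ℕ) (hℓ : P.parts.card = ℓ)
    (hinv : ∀ K ∈ P.parts, ∀ g ∈ K, ∀ h : G, h * g * h⁻¹ ∈ K)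
    (hone : {1} ∈ P.parts)
    (C : Finset G) (hC : ∀ K ∈ P.parts, ∃! c, c ∈ C ∧ c ∈ K)
    (κ : G → C) (hκ : ∀ g, (κ g : G) ∈ P.part g) :
    ((∃ S : SCT.SupercharacterTheory G, S.HasSuperclasses P) ↔
      ∃ (ξ : Fin ℓ → C → ℂ) (m : Fin ℓ → ℕ),
        SCT.IsLinearFactorization (SCT.groupDet κ) (κ 1) ξ m) ∧
    ∀ S : SCT.SupercharacterTheory G, S.HasSuperclasses P →
      ∀ (ξ : Fin ℓ → C → ℂ) (m : Fin ℓ → ℕ),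
        SCT.IsLinearFactorization (SCT.groupDet κ) (κ 1) ξ m →
        ∀ χ : Fin ℓ → G → ℂ,
          (∀ j g, χ j g = (m j : ℂ) * ξ j (κ g) / ((P.part g).card : ℂ)) →
          S.BCh = Set.range χ ∧ ∀ j, χ j 1 = (m j : ℂ) := by
  classical
  have hmem : ∀ g, P.part g ∈ P.parts := fun g => P.part_mem.mpr (Finset.mem_univ g)
  have hself : ∀ g, g ∈ P.part g := fun g => P.mem_part_self.mpr (Finset.mem_univ g)
  have hpartκ : ∀ g, P.part (κ g : G) = P.part g := fun g => P.part_eq_of_mem (hmem g) (hκ g)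
  have hκP : ∀ g h, κ g = κ h ↔ P.part g = P.part h := by
    refine fun g h => ⟨fun e => by rw [← hpartκ g, e, hpartκ], fun e => Subtype.ext ?_⟩
    exact (hC _ (hmem g)).unique ⟨(κ g).2, hκ g⟩ ⟨(κ h).2, e ▸ hκ h⟩
  have hsurj : Function.Surjective κ := fun c => ⟨c, Subtype.ext
    ((hC _ (hmem (c : G))).unique ⟨(κ c).2, hκ c⟩ ⟨c.2, hself c⟩)⟩
  have hconj : ∀ g h, κ (h * g * h⁻¹) = κ g := fun g h =>
    (hκP _ _).mpr (P.part_eq_of_mem (hmem g) (hinv _ (hmem g) g (hself g) h))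
  have hpart1 : P.part 1 = {1} := P.part_eq_of_mem hone (Finset.mem_singleton_self 1)
  have hκ1 : ∀ g, κ g = κ 1 → g = 1 := fun g h => by
    have := hself g
    rwa [(hκP _ _).mp h, hpart1, Finset.mem_singleton] at this
  have hcardC : Fintype.card C = ℓ := by
    rw [← hℓ, Fintype.card_coe]
    refine Finset.card_bij (fun c _ => P.part c) (fun c _ => hmem c) ?_ ?_
    · intro a ha b hb hab
      exact (hC _ (hmem a)).unique ⟨ha, hself a⟩ ⟨hb, by rw [hab]; exact hself b⟩
    · intro K hK
      obtain ⟨c, ⟨hc, hcK⟩, -⟩ := hC K hK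
      exact ⟨c, hc, P.part_eq_of_mem hK hcK⟩
  have hdet := SCT.groupDet_eq_prod_linForm hconj
  have hform1 := SCT.classForm_apply_one hκ1
  have hS : ∀ S : SCT.SupercharacterTheory G, S.HasSuperclasses P →
      Subalgebra.toSubmodule S.toSubalgebra = SCT.fiberSpace κ := fun S h =>
    h.span_eq.symm.trans (SCT.span_setSum_eq_fiberSpace hκP)
  have hmult : ∀ {ξ : Fin ℓ → C → ℂ} {m : Fin ℓ → ℕ},
      SCT.IsLinearFactorization (SCT.groupDet κ) (κ 1) ξ m → ∀ j,
      ∑ ψ with SCT.classForm κ ψ = ξ j, SCT.Irr.degree ψ ^ 2 = m j := by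
    intro ξ m h j
    rw [SCT.sum_multiplicity_eq_of_prod_linForm_eq hform1 h.monic (hdet.symm.trans h.eq_prod),
      Finset.sum_eq_single j]
    · intro i hi hij
      exact absurd (h.distinct (congrArg SCT.linForm (Finset.mem_filter.mp hi).2)) hij
    · intro hj
      simp at hj
  have hrange : ∀ {ξ : Fin ℓ → C → ℂ} {m : Fin ℓ → ℕ},
      SCT.IsLinearFactorization (SCT.groupDet κ) (κ 1) ξ m →
      Set.range (SCT.classForm κ) = Set.range ξ := by
    intro ξ m h
    apply Set.Subset.antisymm
    · rintro _ ⟨φ, rfl⟩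
      by_contra hφ
      -- A form of `φ` missing from `ξ` would have multiplicity zero, but `φ` alone contributes
      -- `φ(1)² > 0`.
      have := SCT.sum_multiplicity_eq_of_prod_linForm_eq hform1 h.monic
        (hdet.symm.trans h.eq_prod) (SCT.classForm κ φ)
      rw [Finset.sum_eq_zero (s := Finset.univ.filter fun j => ξ j = SCT.classForm κ φ)
        fun j hj => absurd ⟨j, (Finset.mem_filter.mp hj).2⟩ hφ, Finset.sum_eq_zero_iff] at this
      have h0 := this φ (by simp)
      exact (pow_pos (SCT.Irr.degree_pos φ) 2).ne' h0
    · rintro _ ⟨j, rfl⟩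
      have := hmult h j
      by_contra hj
      rw [Finset.sum_eq_zero fun ψ hψ =>
        absurd ⟨ψ, (Finset.mem_filter.mp hψ).2⟩ hj] at this
      exact (h.pos j).ne this
  refine ⟨⟨?_, ?_⟩, ?_⟩
  · rintro ⟨S, hSP⟩
    have hcard := SCT.card_range_classForm hsurj hconj (hS S hSP)
    rw [hcardC] at hcard
    let e : Fin ℓ ≃ Set.range (SCT.classForm κ) := (Finite.equivFinOfCardEq hcard).symm
    refine ⟨fun j => (e j).1, fun j => ∑ ψ with SCT.classForm κ ψ = (e j).1,
      SCT.Irr.degree ψ ^ 2, ⟨?_, fun j => ?_, fun i j hij => ?_, fun j => ?_⟩⟩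
    -- Collecting the characters that share a form adds up their exponents `ψ(1)²`.
    · rw [hdet, ← Finset.prod_fiberwise _ fun ψ => e.symm ⟨SCT.classForm κ ψ, ψ, rfl⟩]
      refine Finset.prod_congr rfl fun j _ => ?_
      rw [← Finset.prod_pow_eq_pow_sum]
      refine Finset.prod_congr ?_ fun ψ hψ => ?_
      · ext ψ
        simp [Equiv.symm_apply_eq, Subtype.ext_iff]
      · rw [(Finset.mem_filter.mp hψ).2]
    · obtain ⟨ψ, hψ⟩ := (e j).2
      exact Finset.sum_pos (fun φ _ => pow_pos (SCT.Irr.degree_pos φ) 2) ⟨ψ, by simp [hψ]⟩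
    · exact e.injective (Subtype.ext (SCT.linForm_injective hij))
    · obtain ⟨ψ, hψ⟩ := (e j).2
      rw [← hψ, hform1]
  · rintro ⟨ξ, m, h⟩
    have hξ : Function.Injective ξ := fun i j hij => h.distinct (congrArg SCT.linForm hij)
    have hcard : Nat.card (Set.range (SCT.classForm κ)) = Fintype.card C := by
      rw [hrange h, Nat.card_congr (Equiv.ofInjective ξ hξ).symm, Nat.card_fin, hcardC]
    exact ⟨SCT.supercharacterTheoryOfCard hsurj hconj hκ1 hcard,
      SCT.isOrthIdemBasis_setSum hκP⟩
  · intro S hSP ξ m h χ hχ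
    have hcard := SCT.card_range_classForm hsurj hconj (hS S hSP)
    have hχ1 : ∀ j, χ j 1 = (m j : ℂ) := fun j => by
      rw [hχ, h.monic, hpart1]
      simp
    have key : ∀ (φ : SCT.Irr G) (j : Fin ℓ), SCT.classForm κ φ = ξ j →
        ∀ X : Finset (SCT.Irr G), (∀ ψ, ψ ∈ X ↔ SCT.classForm κ ψ = SCT.classForm κ φ) →
          SCT.sigmaChar X = χ j := by
      intro φ j hφj X hX
      funext g
      have hpart : (Finset.univ.filter fun x => κ x = κ g) = P.part g := by
        ext x
        simp [hκP, P.part_eq_iff_mem (hmem g)]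
      have hne : ((P.part g).card : ℂ) ≠ 0 :=
        Nat.cast_ne_zero.mpr (Finset.card_ne_zero_of_mem (hself g))
      have hm : ∑ ψ ∈ X, SCT.Irr.degree ψ ^ 2 = m j := by
        rw [← hmult h j]
        refine Finset.sum_congr ?_ fun _ _ => rfl
        ext ψ
        simp [hX, hφj]
      have := SCT.sigmaChar_mul_card_fiber hsurj hconj hcard X φ hX g
      rw [hpart, hm, hφj] at this
      rw [hχ, eq_div_iff hne, this]
    refine ⟨?_, hχ1⟩
    ext f
    rw [S.mem_BCh_iff hsurj hconj (hS S hSP)]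
    constructor
    · rintro ⟨φ, hφ⟩
      obtain ⟨j, hj⟩ : SCT.classForm κ φ ∈ Set.range ξ := hrange h ▸ ⟨φ, rfl⟩
      refine ⟨j, ?_⟩
      have hX : ∀ ψ, ψ ∈ (Finset.univ.filter fun ψ => SCT.classForm κ ψ = SCT.classForm κ φ) ↔
          SCT.classForm κ ψ = SCT.classForm κ φ := by simp
      rw [hφ _ hX, key φ j hj.symm _ hX]
    · rintro ⟨j, rfl⟩
      obtain ⟨φ, hφ⟩ : ξ j ∈ Set.range (SCT.classForm κ) := hrange h ▸ ⟨j, rfl⟩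
      exact ⟨φ, fun X hX => (key φ j hφ X hX).symm⟩
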